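/- Let $\mathcal{F}$ be a signature, $\mathcal{V}$ an infinite set of variables, and $\mathcal{R}$ a term rewrite system (TRS) over $\mathcal{F}$ and $\mathcal{V}$, i.e. a (possibly infinite) set of rules $l \to r$ between terms such that $l$ is not a variable and every variable of $r$ occurs in $l$. Suppose that $\mathcal{R}$ is left-linear, i.e. no variable occurs more than once in the left-hand side of a rule. An overlap $(l_1 \to r_1, p, l_2 \to r_2)_\mu$ of $\mathcal{R}$ consists of variants $l_1 \to r_1$ and $l_2 \to r_2$ (under bijective renaming of variables) of rules of $\mathcal{R}$ without common variables, a position $p$ of $l_2$ such that $l_2|_p$ is not a variable, and a most general unifier $\mu$ of $l_1$ and $l_2|_p$; if $p$ is the root position, it is required that $l_1 \to r_1$ and $l_2 \to r_2$ are not variants of each other. The overlap induces the critical pair $l_2\mu[r_1\mu]_p \approx r_2\mu$. The set of critical pair steps of $\mathcal{R}$ is the set of rules \[ \mathsf{CPS}(\mathcal{R}) = \{\, l_2\mu \to l_2\mu[r_1\mu]_p,\ l_2\mu \to r_2\mu \mid (l_1 \to r_1, p, l_2 \to r_2)_\mu \text{ is an overlap of } \mathcal{R} \,\}. \] Suppose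 that every critical pair $s \approx t$ of $\mathcal{R}$ is joinable, i.e. $s \to_{\mathcal{R}}^* w$ and $t \to_{\mathcal{R}}^* w$ for some term $w$, and that $\mathsf{CPS}(\mathcal{R})/\mathcal{R}$ is terminating, i.e. the relation $\to_{\mathcal{R}}^* \cdot \to_{\mathsf{CPS}(\mathcal{R})} \cdot \to_{\mathcal{R}}^*$ on terms admits no infinite sequence of steps. Then $\mathcal{R}$ is confluent: whenever $s \to_{\mathcal{R}}^* t$ and $s \to_{\mathcal{R}}^* u$, there is a term $w$ with $t \to_{\mathcal{R}}^* w$ and $u \to_{\mathcal{R}}^* w$. -/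

import Mathlib

/-!
First-order term rewriting. Terms over a signature with function symbols `L.Functions` and
variables `V` are the terms `L.Term V` of Mathlib (the relation symbols of `L` play no role), and
a substitution is a map `V → L.Term V`, applied to a term `t` as `t.subst σ`.
-/

universe u v w

namespace TermRewriting

/-- The subterm `t|_p` of `t` at position `p`; it is `none` if `p` is not a position of `t`.
The arguments of a function symbol are numbered from `0`. -/
def subtermAt {L : FirstOrder.Language.{u, v}} {V : Type w} : L.Term V → List ℕ → Option (L.Term V)
  | t, [] => some t
  | .var _, _ :: _ => none
  | .func (l := n) _ ts, i :: p => if h : i < n then subtermAt (ts ⟨i, h⟩) p else none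

/-- The term `t[u]_p` obtained from `t` by replacing the subterm at position `p` by `u`
(with the junk value `t` if `p` is not a position of `t`). -/
def replaceAt {L : FirstOrder.Language.{u, v}} {V : Type w} : L.Term V → List ℕ → L.Term V → L.Term V
  | _, [], u => u
  | .var x, _ :: _, _ => .var x
  | .func (l := n) f ts, i :: p, u =>
      if h : i < n then
        .func f (Function.update ts ⟨i, h⟩ (replaceAt (ts ⟨i, h⟩) p u))
      else .func f ts

/-- A term is linear if no variable occurs in it at two different positions. -/
def IsLinear {L : FirstOrder.Language.{u, v}} {V : Type w} (t : L.Term V) : Prop :=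
  ∀ (p q : List ℕ) (x : V),
    subtermAt t p = some (.var x) → subtermAt t q = some (.var x) → p = q

open Classical in
/-- The set of variables that occur in a term. -/
noncomputable def vars {L : FirstOrder.Language.{u, v}} {V : Type w} (t : L.Term V) : Finset V :=
  t.varFinset

/-- A pair of terms `lhs → rhs`. -/
@[ext]
structure Rule (L : FirstOrder.Language.{u, v}) (V : Type w) where
  /-- the left-hand side -/
  lhs : L.Term V
  /-- the right-hand side -/
  rhs : L.Term V

/-- A set of pairs of terms is a term rewrite system if in each of them the left-hand side is not
a variable and every variable of the right-hand side occurs in the left-hand side. -/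
def IsTRS {L : FirstOrder.Language.{u, v}} {V : Type w} (R : Set (Rule L V)) : Prop :=
  ∀ ρ ∈ R, (∀ x : V, ρ.lhs ≠ .var x) ∧ vars ρ.rhs ⊆ vars ρ.lhs

/-- All left-hand sides are linear. -/
def LeftLinear {L : FirstOrder.Language.{u, v}} {V : Type w} (R : Set (Rule L V)) : Prop :=
  ∀ ρ ∈ R, IsLinear ρ.lhs

/-- The rewrite relation `→_R`: the smallest relation that contains all instances `lσ → rσ` of
members of `R` and is closed under contexts. -/
inductive Step {L : FirstOrder.Language.{u, v}} {V : Type w} (R : Set (Rule L V)) :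
    L.Term V → L.Term V → Prop
  | root (ρ : Rule L V) (hρ : ρ ∈ R) (σ : V → L.Term V) :
      Step R (ρ.lhs.subst σ) (ρ.rhs.subst σ)
  | arg {n : ℕ} (f : L.Functions n) (ts : Fin n → L.Term V) (i : Fin n) (t : L.Term V)
      (h : Step R (ts i) t) :
      Step R (.func f ts) (.func f (Function.update ts i t))

/-- The relation `→_R^*`. -/
def Steps {L : FirstOrder.Language.{u, v}} {V : Type w} (R : Set (Rule L V)) :
    L.Term V → L.Term V → Prop :=
  Relation.ReflTransGen (Step R)

/-- The relation `↓`: the terms `s` and `t` have a common reduct. -/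
def Joinable {L : FirstOrder.Language.{u, v}} {V : Type w} (R : Set (Rule L V)) (s t : L.Term V) : Prop :=
  ∃ w : L.Term V, Steps R s w ∧ Steps R t w

/-- Confluence: `t ←^* s →^* u` implies that `t` and `u` have a common reduct. -/
def Confluent {L : FirstOrder.Language.{u, v}} {V : Type w} (R : Set (Rule L V)) : Prop :=
  ∀ s t u : L.Term V, Steps R s t → Steps R s u → Joinable R t u

/-- `A` is relatively terminating with respect to `B`, i.e. `A/B` is terminating: there is no
infinite sequence of steps of the relation `→_B^* · →_A · →_B^*`. -/
def RelTerminating {L : FirstOrder.Language.{u, v}} {V : Type w} (A B : Set (Rule L V)) : Prop :=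
  WellFounded (fun t s : L.Term V =>
    ∃ s' t' : L.Term V, Steps B s s' ∧ Step A s' t' ∧ Steps B t' t)

/-- Two rules are variants if they are equal up to a bijective renaming of variables. -/
def Variant {L : FirstOrder.Language.{u, v}} {V : Type w} (ρ ρ' : Rule L V) : Prop :=
  ∃ π : Equiv.Perm V, ρ'.lhs = ρ.lhs.relabel π ∧ ρ'.rhs = ρ.rhs.relabel π

/-- `μ` is a most general unifier of `s` and `t`: it is a unifier, and every unifier is an
instance of it. -/
def IsMGU {L : FirstOrder.Language.{u, v}} {V : Type w} (μ : V → L.Term V) (s t : L.Term V) : Prop :=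
  s.subst μ = t.subst μ ∧
    ∀ τ : V → L.Term V, s.subst τ = t.subst τ →
      ∃ δ : V → L.Term V, ∀ x : V, τ x = (μ x).subst δ

/-- `(ρ₁, p, ρ₂)_μ` is an overlap of `R`: `ρ₁` and `ρ₂` are variants of members of `R` without
common variables, `p` is the position of a non-variable subterm of the left-hand side of `ρ₂`,
`μ` is a most general unifier of the left-hand side of `ρ₁` and that subterm, and `ρ₁`, `ρ₂`
are not variants if `p` is the root position. -/
structure IsOverlap {L : FirstOrder.Language.{u, v}} {V : Type w} (R : Set (Rule L V))
    (ρ₁ : Rule L V) (p : List ℕ) (ρ₂ : Rule L V) (μ : V → L.Term V) : Prop where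
  variant_left : ∃ ρ ∈ R, Variant ρ ρ₁
  variant_right : ∃ ρ ∈ R, Variant ρ ρ₂
  no_common_vars : ∀ x : V,
    (x ∈ vars ρ₁.lhs ∨ x ∈ vars ρ₁.rhs) → ¬ (x ∈ vars ρ₂.lhs ∨ x ∈ vars ρ₂.rhs)
  unify : ∃ s : L.Term V,
    subtermAt ρ₂.lhs p = some s ∧ (∀ x : V, s ≠ .var x) ∧ IsMGU μ ρ₁.lhs s
  not_variant : p = [] → ¬ Variant ρ₁ ρ₂

/-- `s ≈ t` is a critical pair of `R`: `s = l₂μ[r₁μ]_p` and `t = r₂μ` for some overlap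
`(l₁ → r₁, p, l₂ → r₂)_μ` of `R`. -/
def CriticalPair {L : FirstOrder.Language.{u, v}} {V : Type w} (R : Set (Rule L V))
    (s t : L.Term V) : Prop :=
  ∃ (ρ₁ : Rule L V) (p : List ℕ) (ρ₂ : Rule L V) (μ : V → L.Term V),
    IsOverlap R ρ₁ p ρ₂ μ ∧
      s = replaceAt (ρ₂.lhs.subst μ) p (ρ₁.rhs.subst μ) ∧ t = ρ₂.rhs.subst μ

/-- The set of critical pair steps of `R`: the rules `l₂μ → l₂μ[r₁μ]_p` and `l₂μ → r₂μ` for all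
overlaps `(l₁ → r₁, p, l₂ → r₂)_μ` of `R`. -/
def CPS {L : FirstOrder.Language.{u, v}} {V : Type w} (R : Set (Rule L V)) : Set (Rule L V) :=
  {ρ | ∃ (ρ₁ : Rule L V) (p : List ℕ) (ρ₂ : Rule L V) (μ : V → L.Term V),
    IsOverlap R ρ₁ p ρ₂ μ ∧
      (ρ = ⟨ρ₂.lhs.subst μ, replaceAt (ρ₂.lhs.subst μ) p (ρ₁.rhs.subst μ)⟩ ∨
        ρ = ⟨ρ₂.lhs.subst μ, ρ₂.rhs.subst μ⟩)}

end TermRewriting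

/-!
The terms are ordered by `CPS(R)/R`, which is well founded by assumption, and each term `s` is
shown to be confluent under the hypothesis that all terms below it are.

The local peaks considered are those of parallel steps (`TermRewriting.Par`). Since `R` is
left-linear, a parallel step from an instance `lσ` of a left-hand side either takes place inside
`σ`, or one of its redexes overlaps `l` (`Par.of_subst_linear`). If there are no overlaps, the two
parallel steps of a peak commute in one parallel step on each side. If there is one, both sides of
the peak can be taken to begin with the two steps of an instance of a critical peak; these are
`CPS(R)`-steps, and their results are joinable (`critical_peak_of_overlap`, where the rules are
renamed apart and a most general unifier is found by `exists_isMGU`). This alternative is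
`Par.peak`.

It yields the strip lemma for reducts of `s`: a parallel step can be moved along a rewrite sequence
by diamonds until a critical peak occurs. From there on all terms are below `s`, hence confluent,
and joinability of the critical pair is enough to close the diagram. Confluence of `s` follows from
the strip lemma by induction on the length of one of the two rewrite sequences
(`confluent_of_par_peak`).
-/

namespace TermRewriting

open FirstOrder.Language.Term

variable {L : FirstOrder.Language.{u, v}} {V : Type w}

/-! ### Substitutions, variables and positions -/

theorem mem_vars_var {x y : V} : x ∈ vars (.var y : L.Term V) ↔ x = y := by
  simp [vars, varFinset]

theorem mem_vars_func {n : ℕ} {f : L.Functions n} {ts : Fin n → L.Term V} {x : V} :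
    x ∈ vars (.func f ts) ↔ ∃ i, x ∈ vars (ts i) := by
  simp [vars, varFinset]

theorem subst_subst (t : L.Term V) (σ τ : V → L.Term V) :
    (t.subst σ).subst τ = t.subst fun x => (σ x).subst τ := by
  induction t with
  | var x => rfl
  | func f ts ih => simp [subst, ih]

theorem subst_relabel (t : L.Term V) (g : V → V) (σ : V → L.Term V) :
    (t.relabel g).subst σ = t.subst (σ ∘ g) := by
  induction t with
  | var x => rfl
  | func f ts ih => simp [subst, relabel, ih]

theorem mem_vars_relabel {t : L.Term V} {g : V → V} {x : V} :
    x ∈ vars (t.relabel g) ↔ ∃ y ∈ vars t, g y = x := by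
  induction t with
  | var y => simp [relabel, mem_vars_var, eq_comm]
  | func f ts ih =>
    simp only [relabel, mem_vars_func, ih]
    grind

theorem subst_eq_subst_iff {t : L.Term V} {σ τ : V → L.Term V} :
    t.subst σ = t.subst τ ↔ ∀ x ∈ vars t, σ x = τ x := by
  induction t with
  | var y => simp [subst, mem_vars_var]
  | func f ts ih =>
    simp only [subst, mem_vars_func, FirstOrder.Language.Term.func.injEq, heq_eq_eq, true_and,
      funext_iff, ih]
    grind

theorem subst_var (t : L.Term V) : t.subst .var = t := by
  induction t with
  | var y => rfl
  | func f ts ih => simp [subst, ih]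

theorem subtermAt_func {n : ℕ} (f : L.Functions n) (ts : Fin n → L.Term V) (i : Fin n)
    (p : List ℕ) : subtermAt (.func f ts) (i :: p) = subtermAt (ts i) p := by
  simp [subtermAt]

theorem replaceAt_func {n : ℕ} (f : L.Functions n) (ts : Fin n → L.Term V) (i : Fin n)
    (p : List ℕ) (u : L.Term V) :
    replaceAt (.func f ts) (i :: p) u = .func f (Function.update ts i (replaceAt (ts i) p u)) := by
  simp [replaceAt]

theorem subst_func_update {n : ℕ} (f : L.Functions n) (ts : Fin n → L.Term V) (i : Fin n)
    (t : L.Term V) (σ : V → L.Term V) :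
    subst (.func f (Function.update ts i t)) σ =
      .func f (Function.update (fun j => (ts j).subst σ) i (t.subst σ)) := by
  simp only [subst, FirstOrder.Language.Term.func.injEq, heq_eq_eq, true_and]
  funext j
  by_cases h : j = i
  · subst h; simp
  · simp [h]

theorem subtermAt_subst {t s : L.Term V} {p : List ℕ} (σ : V → L.Term V)
    (h : subtermAt t p = some s) : subtermAt (t.subst σ) p = some (s.subst σ) := by
  induction p generalizing t with
  | nil => simp only [subtermAt, Option.some.injEq] at h ⊢; rw [h]
  | cons i p ih =>
    cases t with
    | var x => simp [subtermAt] at h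
    | @func n f ts =>
      by_cases hi : i < n
      · simp only [subtermAt, subst, hi, dite_true] at h ⊢
        exact ih h
      · simp [subtermAt, hi] at h

/-- Substitution commutes with replacement; `p` has to be a position of `t`, since otherwise a
substitution may turn it into one. -/
theorem replaceAt_subst {t s u : L.Term V} {p : List ℕ} (σ : V → L.Term V)
    (h : subtermAt t p = some s) :
    (replaceAt t p u).subst σ = replaceAt (t.subst σ) p (u.subst σ) := by
  induction p generalizing t with
  | nil => simp [replaceAt]
  | cons i p ih =>
    cases t with
    | var x => simp [subtermAt] at h
    | @func n f ts =>
      by_cases hi : i < n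
      · lift i to Fin n using hi
        rw [subtermAt_func] at h
        rw [replaceAt_func, subst_func_update, ih h, subst, replaceAt_func]
      · simp [subtermAt, hi] at h

theorem exists_subtermAt_of_mem_vars {t : L.Term V} {x : V} (h : x ∈ vars t) :
    ∃ p, subtermAt t p = some (.var x) := by
  induction t with
  | var y => exact ⟨[], by rw [mem_vars_var.1 h, subtermAt]⟩
  | func f ts ih =>
    obtain ⟨i, hi⟩ := mem_vars_func.1 h
    obtain ⟨p, hp⟩ := ih i hi
    exact ⟨i :: p, by rw [subtermAt_func, hp]⟩

theorem vars_subset_of_subtermAt {t s : L.Term V} {p : List ℕ} (h : subtermAt t p = some s) :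
    vars s ⊆ vars t := by
  induction p generalizing t with
  | nil => simp only [subtermAt, Option.some.injEq] at h; rw [h]
  | cons i p ih =>
    cases t with
    | var x => simp [subtermAt] at h
    | @func n f ts =>
      by_cases hi : i < n
      · lift i to Fin n using hi
        rw [subtermAt_func] at h
        exact fun x hx => mem_vars_func.2 ⟨i, ih h hx⟩
      · simp [subtermAt, hi] at h

theorem IsLinear.arg {n : ℕ} {f : L.Functions n} {ts : Fin n → L.Term V}
    (h : IsLinear (.func f ts)) (i : Fin n) : IsLinear (ts i) := by
  intro p q x hp hq
  have := h (i :: p) (i :: q) x (by rw [subtermAt_func, hp]) (by rw [subtermAt_func, hq])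
  exact (List.cons.inj this).2

theorem IsLinear.arg_unique {n : ℕ} {f : L.Functions n} {ts : Fin n → L.Term V}
    (h : IsLinear (.func f ts)) {i j : Fin n} {x : V} (hi : x ∈ vars (ts i))
    (hj : x ∈ vars (ts j)) : i = j := by
  obtain ⟨p, hp⟩ := exists_subtermAt_of_mem_vars hi
  obtain ⟨q, hq⟩ := exists_subtermAt_of_mem_vars hj
  have := h (i :: p) (j :: q) x (by rw [subtermAt_func, hp]) (by rw [subtermAt_func, hq])
  exact Fin.ext (List.cons.inj this).1

/-! ### Most general unifiers -/

/-- The number of occurrences of variables and function symbols in a term. -/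
def size : L.Term V → ℕ
  | .var _ => 1
  | .func _ ts => 1 + ∑ i, size (ts i)

theorem size_pos (t : L.Term V) : 0 < size t := by
  cases t <;> simp [size]

theorem size_le_size_subst {t : L.Term V} {x : V} (h : x ∈ vars t) (σ : V → L.Term V) :
    size (σ x) ≤ size (t.subst σ) := by
  induction t with
  | var y => rw [mem_vars_var.1 h, subst]
  | func f ts ih =>
    obtain ⟨i, hi⟩ := mem_vars_func.1 h
    have := Finset.single_le_sum (f := fun i => size ((ts i).subst σ))
      (fun _ _ => Nat.zero_le _) (Finset.mem_univ i)
    have := ih i hi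
    simp only [subst, size] at *
    omega

/-- The occurs check: `x` and a term `t ≠ x` that contains `x` have no unifier. -/
theorem eq_var_of_subst_eq {t : L.Term V} {x : V} (h : x ∈ vars t) {σ : V → L.Term V}
    (he : σ x = t.subst σ) : t = .var x := by
  cases t with
  | var y => rw [mem_vars_var.1 h]
  | func f ts =>
    obtain ⟨i, hi⟩ := mem_vars_func.1 h
    have h1 := Finset.single_le_sum (f := fun i => size ((ts i).subst σ))
      (fun _ _ => Nat.zero_le _) (Finset.mem_univ i)
    have h2 := size_le_size_subst hi σ
    have h3 := congrArg size he
    simp only [subst, size] at *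
    omega

/-- `σ` solves all equations of the list `E`. -/
def Unifies (σ : V → L.Term V) (E : List (L.Term V × L.Term V)) : Prop :=
  ∀ e ∈ E, e.1.subst σ = e.2.subst σ

/-- `μ` solves `E`, and every solution `τ` of `E` is an instance of `μ` by way of `τ` itself. -/
def IsIdempotentMGU (μ : V → L.Term V) (E : List (L.Term V × L.Term V)) : Prop :=
  Unifies μ E ∧ ∀ τ, Unifies τ E → ∀ x, τ x = (μ x).subst τ

theorem unifies_cons {σ : V → L.Term V} {s t : L.Term V} {E : List (L.Term V × L.Term V)} :
    Unifies σ ((s, t) :: E) ↔ s.subst σ = t.subst σ ∧ Unifies σ E := by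
  simp [Unifies]

theorem unifies_map_subst {σ ρ : V → L.Term V} {E : List (L.Term V × L.Term V)} :
    Unifies σ (E.map fun e => (e.1.subst ρ, e.2.subst ρ)) ↔
      Unifies (fun x => (ρ x).subst σ) E := by
  simp only [Unifies, List.forall_mem_map, subst_subst]

theorem unifies_func {σ : V → L.Term V} {n : ℕ} {f : L.Functions n} {ss ts : Fin n → L.Term V}
    {E : List (L.Term V × L.Term V)} :
    Unifies σ ((.func f ss, .func f ts) :: E) ↔
      Unifies σ (List.ofFn (fun i => (ss i, ts i)) ++ E) := by
  simp only [Unifies, List.mem_cons, List.mem_append, List.mem_ofFn, forall_eq_or_imp, subst,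
    FirstOrder.Language.Term.func.injEq, heq_eq_eq, true_and, funext_iff]
  constructor
  · rintro ⟨h1, h2⟩ e (⟨i, rfl⟩ | h)
    exacts [h1 i, h2 e h]
  · exact fun h => ⟨fun i => h (ss i, ts i) (.inl ⟨i, rfl⟩), fun e he => h e (.inr he)⟩

theorem IsIdempotentMGU.congr {μ : V → L.Term V} {E F : List (L.Term V × L.Term V)}
    (h : IsIdempotentMGU μ E) (hEF : ∀ τ, Unifies τ E ↔ Unifies τ F) : IsIdempotentMGU μ F :=
  ⟨(hEF _).1 h.1, fun τ hτ => h.2 τ ((hEF _).2 hτ)⟩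

open Classical in
/-- The substitution that replaces `x` by `t`. -/
noncomputable def single (x : V) (t : L.Term V) : V → L.Term V :=
  Function.update .var x t

theorem single_subst_eq {x : V} {t : L.Term V} {τ : V → L.Term V} (h : τ x = t.subst τ) :
    (fun y => (single x t y).subst τ) = τ := by
  funext y
  by_cases hy : y = x
  · subst hy; simp [single, h]
  · simp [single, hy, subst]

theorem subst_single_of_notMem {x : V} {s t : L.Term V} (h : x ∉ vars s) :
    s.subst (single x t) = s := by
  conv_rhs => rw [← subst_var s]
  refine subst_eq_subst_iff.2 fun y hy => ?_
  have : y ≠ x := fun e => h (e ▸ hy)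
  simp [single, this]

theorem IsIdempotentMGU.cons_var {x : V} {t : L.Term V} {E : List (L.Term V × L.Term V)}
    {μ : V → L.Term V} (hx : x ∉ vars t)
    (h : IsIdempotentMGU μ (E.map fun e => (e.1.subst (single x t), e.2.subst (single x t)))) :
    IsIdempotentMGU (fun y => (single x t y).subst μ) ((.var x, t) :: E) := by
  refine ⟨unifies_cons.2 ⟨?_, unifies_map_subst.1 h.1⟩, fun τ hτ y => ?_⟩
  · rw [← subst_subst, ← subst_subst, subst_single_of_notMem hx]
    simp [subst, single]
  · obtain ⟨h1, h2⟩ := unifies_cons.1 hτ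
    have hs := single_subst_eq (t := t) (x := x) (τ := τ) h1
    have hμ := h.2 τ (unifies_map_subst.2 (by rwa [hs]))
    have : (fun z => (μ z).subst τ) = τ := funext fun z => (hμ z).symm
    rw [subst_subst, this]
    exact (congrFun hs y).symm

/-- Solvable equations have a most general solution. The solution `θ` given in advance makes a
simple measure for the unification algorithm: eliminating a variable does not change the instances
by `θ` of the other equations, so that the total size of the instances (of the left-hand sides, say)
decreases in each step. -/
theorem exists_isIdempotentMGU (θ : V → L.Term V) (E : List (L.Term V × L.Term V))
    (hE : Unifies θ E) : ∃ μ, IsIdempotentMGU μ E := by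
  induction hm : (E.map fun e => size (e.1.subst θ)).sum using Nat.strong_induction_on
    generalizing E with
  | _ m ih =>
  have elim (x : V) (t : L.Term V) (F : List (L.Term V × L.Term V))
      (hF : Unifies θ ((.var x, t) :: F)) (hlt : (F.map fun e => size (e.1.subst θ)).sum < m) :
      ∃ μ, IsIdempotentMGU μ ((.var x, t) :: F) := by
    obtain ⟨h1, h2⟩ := unifies_cons.1 hF
    by_cases hx : x ∈ vars t
    · obtain ⟨μ, hμ⟩ := ih _ hlt F h2 rfl
      refine ⟨μ, hμ.congr fun τ => ?_⟩
      rw [eq_var_of_subst_eq hx h1, unifies_cons]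
      simp
    · have hs := single_subst_eq (t := t) (x := x) (τ := θ) h1
      obtain ⟨μ, hμ⟩ := ih _ hlt (F.map fun e => (e.1.subst (single x t), e.2.subst (single x t)))
        (unifies_map_subst.2 (by rwa [hs])) (by simp [Function.comp_def, subst_subst, hs])
      exact ⟨_, hμ.cons_var hx⟩
  match E with
  | [] => exact ⟨.var, by simp [Unifies], fun τ _ x => rfl⟩
  | (s, t) :: F =>
    have hlt : (F.map fun e => size (e.1.subst θ)).sum < m := by
      have := size_pos (s.subst θ)
      simp at hm
      omega
    match s, t with
    | .var x, t => exact elim x t F hE hlt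
    | .func f ss, .var x =>
      have hswap (τ : V → L.Term V) :
          Unifies τ ((.var x, .func f ss) :: F) ↔ Unifies τ ((.func f ss, .var x) :: F) := by
        rw [unifies_cons, unifies_cons, eq_comm]
      obtain ⟨μ, hμ⟩ := elim x (.func f ss) F ((hswap _).2 hE) hlt
      exact ⟨μ, hμ.congr hswap⟩
    | .func (l := n) f ss, .func (l := k) g ts =>
      have h := (unifies_cons.1 hE).1
      simp only [subst, FirstOrder.Language.Term.func.injEq] at h
      obtain ⟨rfl, hfg, -⟩ := h
      obtain rfl := eq_of_heq hfg
      obtain ⟨μ, hμ⟩ := ih _ (by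
        simp only [List.map_cons, List.sum_cons, subst, size] at hm
        simp only [List.map_append, List.map_ofFn, List.sum_append, List.sum_ofFn,
          Function.comp_apply] at hm ⊢
        omega) _ (unifies_func.1 hE) rfl
      exact ⟨μ, hμ.congr fun τ => unifies_func.symm⟩

theorem exists_isMGU {s t : L.Term V} {θ : V → L.Term V} (h : s.subst θ = t.subst θ) :
    ∃ μ, IsMGU μ s t := by
  have key (τ : V → L.Term V) : Unifies τ [(s, t)] ↔ s.subst τ = t.subst τ := by simp [Unifies]
  obtain ⟨μ, h1, h2⟩ := exists_isIdempotentMGU θ [(s, t)] ((key θ).2 h)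
  exact ⟨μ, (key μ).1 h1, fun τ hτ => ⟨τ, h2 τ ((key τ).2 hτ)⟩⟩

/-- Finitely many variables can be renamed away from a given finite set. -/
theorem exists_perm_forall_notMem [Infinite V] (A B : Finset V) :
    ∃ π : Equiv.Perm V, ∀ a ∈ A, π a ∉ B := by
  classical
  induction A using Finset.induction_on with
  | empty => exact ⟨1, by simp⟩
  | insert a A ha ih =>
    obtain ⟨π, hπ⟩ := ih
    obtain ⟨c, hc⟩ := Infinite.exists_notMem_finset (B ∪ A.image π)
    simp only [Finset.mem_union, Finset.mem_image, not_or, not_exists, not_and] at hc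
    refine ⟨π.trans (Equiv.swap (π a) c), fun b hb => ?_⟩
    rcases Finset.mem_insert.1 hb with rfl | hb
    · simpa using hc.1
    · have h1 : π b ≠ π a := fun e => ha (π.injective e ▸ hb)
      have h2 : π b ≠ c := hc.2 b hb
      simpa [Equiv.swap_apply_of_ne_of_ne h1 h2] using hπ b hb

/-! ### Rewriting and parallel rewriting -/

variable {R : Set (Rule L V)}

theorem Step.subst {s t : L.Term V} (h : Step R s t) (δ : V → L.Term V) :
    Step R (s.subst δ) (t.subst δ) := by
  induction h with
  | root ρ hρ σ => simpa only [subst_subst] using Step.root ρ hρ _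
  | arg f ts i t h ih =>
    rw [subst_func_update]
    exact Step.arg f (fun j => (ts j).subst δ) i _ ih

theorem Steps.subst {s t : L.Term V} (h : Steps R s t) (δ : V → L.Term V) :
    Steps R (s.subst δ) (t.subst δ) :=
  Relation.ReflTransGen.lift (fun s : L.Term V => s.subst δ) (fun _ _ h => h.subst δ) _ _ h

theorem Joinable.subst {s t : L.Term V} (h : Joinable R s t) (δ : V → L.Term V) :
    Joinable R (s.subst δ) (t.subst δ) :=
  let ⟨w, h1, h2⟩ := h
  ⟨w.subst δ, h1.subst δ, h2.subst δ⟩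

theorem Joinable.symm {s t : L.Term V} (h : Joinable R s t) : Joinable R t s :=
  let ⟨w, h1, h2⟩ := h
  ⟨w, h2, h1⟩

theorem Steps.update {n : ℕ} (f : L.Functions n) (ts : Fin n → L.Term V) (i : Fin n)
    {s t : L.Term V} (h : Steps R s t) :
    Steps R (.func f (Function.update ts i s)) (.func f (Function.update ts i t)) := by
  refine Relation.ReflTransGen.lift
    (fun s : L.Term V => FirstOrder.Language.Term.func f (Function.update ts i s)) (fun a b h => ?_) _ _ h
  have := Step.arg f (Function.update ts i a) i b (by simpa using h)
  simpa using this

theorem Steps.func {n : ℕ} (f : L.Functions n) {ss ts : Fin n → L.Term V}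
    (h : ∀ i, Steps R (ss i) (ts i)) : Steps R (.func f ss) (.func f ts) := by
  classical
  suffices ∀ S : Finset (Fin n), Steps R (.func f ss) (.func f (S.piecewise ts ss)) by
    simpa using this Finset.univ
  intro S
  induction S using Finset.induction_on with
  | empty => rw [Finset.piecewise_empty]; exact Relation.ReflTransGen.refl
  | insert i S hi ih =>
    rw [Finset.piecewise_insert]
    refine Relation.ReflTransGen.trans ih ?_
    have := Steps.update f (S.piecewise ts ss) i (h i)
    rwa [← Finset.piecewise_eq_of_notMem S ts ss hi, Function.update_eq_self] at this

/-- Parallel rewriting: contraction of any number of redexes at pairwise parallel positions. -/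
inductive Par (R : Set (Rule L V)) : L.Term V → L.Term V → Prop
  | var (x : V) : Par R (.var x) (.var x)
  | root (ρ : Rule L V) (hρ : ρ ∈ R) (σ : V → L.Term V) {s t : L.Term V}
      (hs : s = ρ.lhs.subst σ) (ht : t = ρ.rhs.subst σ) : Par R s t
  | func {n : ℕ} (f : L.Functions n) (ss ts : Fin n → L.Term V) (h : ∀ i, Par R (ss i) (ts i)) :
      Par R (.func f ss) (.func f ts)

theorem Par.refl (t : L.Term V) : Par R t t := by
  induction t with
  | var x => exact .var x
  | func f ts ih => exact .func f ts ts ih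

theorem Par.update {n : ℕ} (f : L.Functions n) {ss ts : Fin n → L.Term V}
    (h : ∀ i, Par R (ss i) (ts i)) (i : Fin n) {t : L.Term V} (ht : Par R t (ts i)) :
    Par R (.func f (Function.update ss i t)) (.func f ts) := by
  refine .func _ _ _ fun j => ?_
  by_cases hj : j = i
  · subst hj; simpa
  · simpa [hj] using h j

theorem Par.subst (t : L.Term V) {σ τ : V → L.Term V} (h : ∀ x, Par R (σ x) (τ x)) :
    Par R (t.subst σ) (t.subst τ) := by
  induction t with
  | var x => exact h x
  | func f ts ih => exact .func f _ _ ih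

theorem Step.par {s t : L.Term V} (h : Step R s t) : Par R s t := by
  induction h with
  | root ρ hρ σ => exact .root ρ hρ σ rfl rfl
  | arg f ts i t h ih =>
    refine .func _ _ _ fun j => ?_
    by_cases hj : j = i
    · subst hj; simpa
    · simpa [hj] using Par.refl (ts j)

theorem Par.steps {s t : L.Term V} (h : Par R s t) : Steps R s t := by
  induction h with
  | var x => exact .refl
  | root ρ hρ σ hs ht =>
    subst hs ht
    exact .single (.root ρ hρ σ)
  | func f ss ts h ih => exact Steps.func f ih

/-- A parallel step from an instance `lσ` of a linear term `l` either takes place in the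
substitution, or it contracts a redex at a non-variable position `p` of `l`, in which case that
redex can be contracted first. -/
theorem Par.of_subst_linear {l t : L.Term V} (hl : IsLinear l) {σ : V → L.Term V}
    (h : Par R (l.subst σ) t) :
    (∃ τ : V → L.Term V, t = l.subst τ ∧ ∀ x, Par R (σ x) (τ x)) ∨
    ∃ p s, subtermAt l p = some s ∧ (∀ x : V, s ≠ .var x) ∧ ∃ ρ ∈ R, ∃ σ' : V → L.Term V,
      s.subst σ = ρ.lhs.subst σ' ∧ Par R (replaceAt (l.subst σ) p (ρ.rhs.subst σ')) t := by
  classical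
  induction l generalizing t with
  | var x =>
    refine .inl ⟨Function.update σ x t, by simp, fun y => ?_⟩
    by_cases hy : y = x
    · subst hy; simpa using h
    · simpa [hy] using Par.refl (σ y)
  | @func n f ls ih =>
    rw [FirstOrder.Language.Term.subst] at h
    generalize hss : (fun i => (ls i).subst σ) = ss at h
    cases h with
    | root ρ hρ σ' hs ht =>
      subst hss
      refine .inr ⟨[], _, rfl, by simp, ρ, hρ, σ', hs, ?_⟩
      rw [ht]
      exact Par.refl _
    | func _ _ ts hts =>
      subst hss
      by_cases hA : ∀ i, ∃ τ : V → L.Term V, ts i = (ls i).subst τ ∧ ∀ x, Par R (σ x) (τ x)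
      · choose τ hτ hστ using hA
        -- By linearity each variable occurs in at most one argument, so the `τ i` can be merged.
        refine .inl ⟨fun x => if hx : ∃ i, x ∈ vars (ls i) then τ hx.choose x else σ x, ?_, ?_⟩
        · rw [FirstOrder.Language.Term.subst]
          congr 1
          funext i
          rw [hτ i, subst_eq_subst_iff]
          intro x hx
          have hex : ∃ i, x ∈ vars (ls i) := ⟨i, hx⟩
          rw [dif_pos hex, hl.arg_unique hex.choose_spec hx]
        · intro x
          by_cases hx : ∃ i, x ∈ vars (ls i)
          · simpa only [hx, dite_true] using hστ _ x
          · simpa only [hx, dite_false] using Par.refl (σ x)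
      · push Not at hA
        obtain ⟨i, hi⟩ := hA
        rcases ih i (hl.arg i) (hts i) with ⟨τ, h1, h2⟩ | ⟨p, s, hp, hs, ρ, hρ, σ', he, hpar⟩
        · obtain ⟨x, hx⟩ := hi τ h1
          exact absurd (h2 x) hx
        · refine .inr ⟨i :: p, s, by rw [subtermAt_func, hp], hs, ρ, hρ, σ', he, ?_⟩
          rw [FirstOrder.Language.Term.subst, replaceAt_func]
          exact Par.update f hts i hpar

/-! ### Critical peaks -/

/-- `s` rewrites to `t` and to `u` by the two steps of a critical peak in some context, up to
further rewriting on both sides, and the terms reached by these two steps are joinable. -/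
def CriticalPeak (R : Set (Rule L V)) (s t u : L.Term V) : Prop :=
  ∃ t' u', Step (CPS R) s t' ∧ Step (CPS R) s u' ∧ Joinable R t' u' ∧ Steps R t' t ∧ Steps R u' u

theorem CriticalPeak.symm {s t u : L.Term V} (h : CriticalPeak R s t u) : CriticalPeak R s u t :=
  let ⟨t', u', h1, h2, h3, h4, h5⟩ := h
  ⟨u', t', h2, h1, h3.symm, h5, h4⟩

theorem CriticalPeak.func {n : ℕ} (f : L.Functions n) {ss ts us : Fin n → L.Term V}
    (ht : ∀ i, Par R (ss i) (ts i)) (hu : ∀ i, Par R (ss i) (us i)) (i : Fin n)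
    (h : CriticalPeak R (ss i) (ts i) (us i)) :
    CriticalPeak R (.func f ss) (.func f ts) (.func f us) := by
  obtain ⟨t', u', h1, h2, ⟨w, h3, h3'⟩, h4, h5⟩ := h
  have key {vs : Fin n → L.Term V} (hv : ∀ i, Par R (ss i) (vs i)) {v' : L.Term V}
      (h : Steps R v' (vs i)) :
      Steps R (.func f (Function.update ss i v')) (.func f vs) := by
    refine Steps.func f fun j => ?_
    by_cases hj : j = i
    · subst hj; simpa
    · simpa [hj] using (hv j).steps
  exact ⟨_, _, .arg f ss i t' h1, .arg f ss i u' h2,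
    ⟨_, Steps.update f ss i h3, Steps.update f ss i h3'⟩, key ht h4, key hu h5⟩

/-- Variants contract a common redex at its root to the same term. -/
theorem Variant.rhs_subst_eq {ρ ρ' : Rule L V} (h : Variant ρ ρ')
    (hvars : vars ρ.rhs ⊆ vars ρ.lhs)
    {σ σ' : V → L.Term V} (he : ρ.lhs.subst σ = ρ'.lhs.subst σ') :
    ρ.rhs.subst σ = ρ'.rhs.subst σ' := by
  obtain ⟨π, h1, h2⟩ := h
  rw [h1, subst_relabel, subst_eq_subst_iff] at he
  rw [h2, subst_relabel, subst_eq_subst_iff]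
  exact fun x hx => he x (hvars hx)

/-- Two redexes that overlap at a non-variable position are contracted to the same term (if they
overlap at the root and the rules are variants), or they form an instance of a critical peak. -/
theorem critical_peak_of_overlap [Infinite V] (hR : IsTRS R)
    (hjoin : ∀ s t : L.Term V, CriticalPair R s t → Joinable R s t)
    {ρ₁ ρ₂ : Rule L V} (hρ₁ : ρ₁ ∈ R) (hρ₂ : ρ₂ ∈ R) {p : List ℕ} {s : L.Term V}
    (hp : subtermAt ρ₂.lhs p = some s) (hs : ∀ x : V, s ≠ .var x) {σ₁ σ₂ : V → L.Term V}
    (he : s.subst σ₂ = ρ₁.lhs.subst σ₁) :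
    replaceAt (ρ₂.lhs.subst σ₂) p (ρ₁.rhs.subst σ₁) = ρ₂.rhs.subst σ₂ ∨
    CriticalPeak R (ρ₂.lhs.subst σ₂) (replaceAt (ρ₂.lhs.subst σ₂) p (ρ₁.rhs.subst σ₁))
      (ρ₂.rhs.subst σ₂) := by
  classical
  obtain ⟨π, hπ⟩ := exists_perm_forall_notMem (vars ρ₁.lhs) (vars ρ₂.lhs)
  set ρ₁' : Rule L V := ⟨ρ₁.lhs.relabel π, ρ₁.rhs.relabel π⟩ with hρ₁'
  have hvar : Variant ρ₁ ρ₁' := ⟨π, rfl, rfl⟩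
  have hvars₁ : vars ρ₁'.rhs ⊆ vars ρ₁'.lhs := by
    intro x hx
    obtain ⟨y, hy, rfl⟩ := mem_vars_relabel.1 hx
    exact mem_vars_relabel.2 ⟨y, (hR ρ₁ hρ₁).2 hy, rfl⟩
  have hvars₂ := (hR ρ₂ hρ₂).2
  have hdisj : ∀ x ∈ vars ρ₁'.lhs, x ∉ vars ρ₂.lhs := by
    intro x hx
    obtain ⟨y, hy, rfl⟩ := mem_vars_relabel.1 hx
    exact hπ y hy
  -- On the variables of the two rules, which are disjoint now, `τ` agrees with `σ₁` (up to the
  -- renaming) and with `σ₂`, respectively.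
  set τ : V → L.Term V := fun x => if x ∈ vars ρ₂.lhs then σ₂ x else σ₁ (π.symm x) with hτ
  have hτ₂ {t : L.Term V} (ht : vars t ⊆ vars ρ₂.lhs) : t.subst τ = t.subst σ₂ :=
    subst_eq_subst_iff.2 fun x hx => by simp [hτ, ht hx]
  have hτ₁ {t : L.Term V} (ht : vars t ⊆ vars ρ₁.lhs) : (t.relabel π).subst τ = t.subst σ₁ := by
    rw [subst_relabel, subst_eq_subst_iff]
    exact fun x hx => by simp [hτ, hπ x (ht hx)]
  have hl₁ : ρ₁'.lhs.subst τ = ρ₁.lhs.subst σ₁ := hτ₁ subset_rfl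
  have hr₁ : ρ₁'.rhs.subst τ = ρ₁.rhs.subst σ₁ := hτ₁ (hR ρ₁ hρ₁).2
  have hsτ : s.subst τ = s.subst σ₂ := hτ₂ (vars_subset_of_subtermAt hp)
  have hu : ρ₁'.lhs.subst τ = s.subst τ := by rw [hl₁, hsτ, he]
  by_cases hv : p = [] ∧ Variant ρ₁' ρ₂
  · obtain ⟨rfl, hv⟩ := hv
    simp only [subtermAt, Option.some.injEq] at hp
    left
    rw [replaceAt, ← hr₁]
    exact hv.rhs_subst_eq hvars₁ (by rw [hl₁, ← he, hp])
  · right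
    obtain ⟨μ, hμ⟩ := exists_isMGU hu
    obtain ⟨δ, hδ⟩ := hμ.2 τ hu
    have hinst (t : L.Term V) : (t.subst μ).subst δ = t.subst τ := by
      rw [subst_subst]
      exact congrArg _ (funext fun x => (hδ x).symm)
    have hov : IsOverlap R ρ₁' p ρ₂ μ :=
      { variant_left := ⟨ρ₁, hρ₁, hvar⟩
        variant_right := ⟨ρ₂, hρ₂, 1, by simp, by simp⟩
        no_common_vars := fun x h1 h2 =>
          hdisj x (h1.elim id fun h => hvars₁ h) (h2.elim id fun h => hvars₂ h)
        unify := ⟨s, hp, hs, hμ⟩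
        not_variant := fun h1 h2 => hv ⟨h1, h2⟩ }
    have h0 : (ρ₂.lhs.subst μ).subst δ = ρ₂.lhs.subst σ₂ := by rw [hinst, hτ₂ subset_rfl]
    have h1 : (replaceAt (ρ₂.lhs.subst μ) p (ρ₁'.rhs.subst μ)).subst δ =
        replaceAt (ρ₂.lhs.subst σ₂) p (ρ₁.rhs.subst σ₁) := by
      rw [replaceAt_subst δ (subtermAt_subst μ hp), h0, hinst, hr₁]
    have h2 : (ρ₂.rhs.subst μ).subst δ = ρ₂.rhs.subst σ₂ := by rw [hinst, hτ₂ hvars₂]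
    refine ⟨_, _, ?_, ?_, ?_, .refl, .refl⟩
    · rw [← h1, ← h0]
      exact Step.root (R := CPS R) ⟨_, _⟩ ⟨_, _, _, _, hov, .inl rfl⟩ δ
    · rw [← h2, ← h0]
      exact Step.root (R := CPS R) ⟨_, _⟩ ⟨_, _, _, _, hov, .inr rfl⟩ δ
    · rw [← h1, ← h2]
      exact (hjoin _ _ ⟨_, _, _, _, hov, rfl, rfl⟩).subst δ

theorem Par.peak_root [Infinite V] (hR : IsTRS R) (hlin : LeftLinear R)
    (hjoin : ∀ s t : L.Term V, CriticalPair R s t → Joinable R s t)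
    {ρ : Rule L V} (hρ : ρ ∈ R) {σ : V → L.Term V} {u : L.Term V}
    (hu : Par R (ρ.lhs.subst σ) u) :
    (∃ v, Par R (ρ.rhs.subst σ) v ∧ Par R u v) ∨
      CriticalPeak R (ρ.lhs.subst σ) (ρ.rhs.subst σ) u := by
  rcases hu.of_subst_linear (hlin ρ hρ) with
    ⟨τ, rfl, hτ⟩ | ⟨p, s, hp, hs, ρ', hρ', σ', he, hpar⟩
  · exact .inl ⟨ρ.rhs.subst τ, Par.subst _ hτ, .root ρ hρ τ rfl rfl⟩
  · rcases critical_peak_of_overlap hR hjoin hρ' hρ hp hs he with h | ⟨t', u', h1, h2, h3, h4, h5⟩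
    · exact .inl ⟨u, h ▸ hpar, Par.refl u⟩
    · exact .inr ⟨u', t', h2, h1, h3.symm, h5, h4.trans hpar.steps⟩

/-- Parallel rewriting has the diamond property except at critical peaks. -/
theorem Par.peak [Infinite V] (hR : IsTRS R) (hlin : LeftLinear R)
    (hjoin : ∀ s t : L.Term V, CriticalPair R s t → Joinable R s t)
    {s t u : L.Term V} (ht : Par R s t) (hu : Par R s u) :
    (∃ v, Par R t v ∧ Par R u v) ∨ CriticalPeak R s t u := by
  induction ht generalizing u with
  | var x => exact .inl ⟨u, hu, Par.refl u⟩
  | root ρ hρ σ hs ht =>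
    subst hs ht
    exact Par.peak_root hR hlin hjoin hρ hu
  | func f ss ts hts ih =>
    cases hu with
    | root ρ hρ σ hs hu =>
      subst hu
      have hpar := Par.func f ss ts hts
      rw [hs] at hpar ⊢
      exact (Par.peak_root hR hlin hjoin hρ hpar).imp
        (fun ⟨v, h1, h2⟩ => ⟨v, h2, h1⟩) CriticalPeak.symm
    | func _ _ us hus =>
      by_cases hA : ∃ i, CriticalPeak R (ss i) (ts i) (us i)
      · obtain ⟨i, hi⟩ := hA
        exact .inr (CriticalPeak.func f hts hus i hi)
      · have hB (i) := (ih i (hus i)).resolve_right fun h => hA ⟨i, h⟩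
        choose vs h1 h2 using hB
        exact .inl ⟨_, .func f ts vs h1, .func f us vs h2⟩

/-! ### Confluence -/

/-- The proof is by well-founded induction on `CPS(R)/R`: a term is confluent if all terms below it
are. Closing a rewrite sequence against a parallel step, one either completes diamonds, or meets a
critical peak, below which the induction hypothesis applies. -/
theorem confluent_of_par_peak (hterm : RelTerminating (CPS R) R)
    (hpeak : ∀ s t u : L.Term V, Par R s t → Par R s u →
      (∃ v, Par R t v ∧ Par R u v) ∨ CriticalPeak R s t u) :
    Confluent R := by
  intro s
  induction s using hterm.induction with
  | _ s ih =>
  have strip {s₀ t u : L.Term V} (hs : Steps R s s₀) (ht : Par R s₀ t) (hu : Steps R s₀ u) :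
      Joinable R t u := by
    induction hu using Relation.ReflTransGen.head_induction_on generalizing t with
    | refl => exact ⟨t, .refl, ht.steps⟩
    | @head s₀ s₁ h01 h1u ih' =>
      rcases hpeak s₀ t s₁ ht h01.par with
        ⟨v, htv, hv⟩ | ⟨t', u', hst, hsu, ⟨w, h1, h2⟩, h3, h4⟩
      · obtain ⟨w, h1, h2⟩ := ih' (hs.tail h01) hv
        exact ⟨w, htv.steps.trans h1, h2⟩
      · -- Below the critical peak all terms are confluent by the induction hypothesis.
        obtain ⟨a, hta, hwa⟩ := ih t' ⟨s₀, t', hs, hst, .refl⟩ t w h3 h1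
        obtain ⟨b, hab, hub⟩ := ih u' ⟨s₀, u', hs, hsu, .refl⟩ a u (h2.trans hwa) (h4.trans h1u)
        exact ⟨b, hta.trans hab, hub⟩
  intro t u ht hu
  suffices ∀ {s₀ u : L.Term V}, Steps R s s₀ → Steps R s₀ t → Steps R s₀ u → Joinable R t u from
    this .refl ht hu
  intro s₀ u hs h0t hu
  induction h0t using Relation.ReflTransGen.head_induction_on generalizing u with
  | refl => exact ⟨u, hu, .refl⟩
  | @head s₀ s₁ h01 _ ih' =>
    obtain ⟨v, h1, h2⟩ := strip hs h01.par hu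
    obtain ⟨w, h3, h4⟩ := ih' (hs.tail h01) h1
    exact ⟨w, h3, h2.trans h4⟩

end TermRewriting

theorem mainTheorem1 {L : FirstOrder.Language.{u, v}} {V : Type w} [Infinite V]
    (R : Set (TermRewriting.Rule L V))
    (hR : TermRewriting.IsTRS R)
    (hlin : TermRewriting.LeftLinear R)
    (hjoin : ∀ s t : L.Term V, TermRewriting.CriticalPair R s t → TermRewriting.Joinable R s t)
    (hterm : TermRewriting.RelTerminating (TermRewriting.CPS R) R) :
    TermRewriting.Confluent R :=
  TermRewriting.confluent_of_par_peak hterm fun _ _ _ =>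
    TermRewriting.Par.peak hR hlin hjoin
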